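/- Theorem (thm:thresholdedbanditTS). There is an absolute constant $C>0$ such that the following holds for all integers $d\ge 1$, $T\ge 0$ and every real $\underline{L}^*\ge 2$ for which $\gamma:=\frac{\log^2(\underline{L}^*)}{\underline{L}^*}\le\frac{1}{2d}$. Let the loss sequence $(\ell_1,\dots,\ell_T)\in([0,1]^d)^T$ be random with an arbitrary joint distribution (the prior), known to the player. Let $L^*=\min_{i\in[d]}\sum_{t=1}^T\ell_t(i)$, and let $a^*$ be an arm attaining this minimum (ties broken by an arbitrary measurable rule that depends on the loss sequence only). Suppose that $L^*\le\underline{L}^*$ almost surely. In round $t$ the player plays an arm $a_t\in[d]$ and then observes only $\ell_t(a_t)$ (bandit feedback). Let $p_t(i)=\mathbb{P}\left[a^*=i\mid a_1,\ell_1(a_1),\dots,a_{t-1},\ell_{t-1}(a_{t-1})\right]$ be the posterior probability that $i$ is the best arm, and let $\mathcal{R}_t=\{i: p_t(i)\le\gamma\}$ be the set of rare arms. Suppose the player uses Thompson Sampling thresholded at $\gamma$: given the whole loss sequence and the earlier arms $a_1,\dots,a_{t-1}$, the arm $a_t$ is drawn from the distribution \[\hat p_t(i)=\begin{cases}0 &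 \text{if } i\in\mathcal{R}_t,\\[2pt] \dfrac{p_t(i)}{1-\sum_{j\in\mathcal{R}_t}p_t(j)} & \text{if } i\notin\mathcal{R}_t.\end{cases}\] Then \[\mathbb{E}[R_T]=\mathbb{E}\left[\sum_{t=1}^T\ell_t(a_t)-L^*\right]\le C\left(\sqrt{d\,\underline{L}^*}+d\log^2(\underline{L}^*)\right).\] In particular the bound does not depend on $T$. -/

import Mathlib

open MeasureTheory Set

/-! Bayesian adversarial bandits with `d` arms and horizon `T`.  A loss sequence is a function
`x : Fin T → Fin d → ℝ`, where `x t i` is the loss of arm `i` in round `t`. -/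

/-- Total loss of arm `i` over all rounds. -/
noncomputable def armLoss {d T : ℕ} (x : Fin T → Fin d → ℝ) (i : Fin d) : ℝ :=
  ∑ t, x t i

/-- The loss `L*` of the best fixed arm in hindsight. -/
noncomputable def bestLoss {d T : ℕ} (x : Fin T → Fin d → ℝ) : ℝ :=
  ⨅ i, armLoss x i

/-- `s` selects, in a measurable way, an arm `a*` of minimal total loss; ties are broken
arbitrarily. -/
structure IsBestArmSelector {d T : ℕ} (s : (Fin T → Fin d → ℝ) → Fin d) : Prop where
  measurable : Measurable s
  minimal : ∀ x i, armLoss x (s x) ≤ armLoss x i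

/-- The information of the player at the beginning of round `t` under bandit feedback:
the arms played in the earlier rounds and the losses of these arms in these rounds. -/
@[reducible] def banditHistory {d T : ℕ} {Ω : Type*} (loss : Ω → Fin T → Fin d → ℝ)
    (a : Fin T → Ω → Fin d) (t : Fin T) : MeasurableSpace Ω :=
  ⨆ s : Fin T, ⨆ _ : s < t,
    (MeasurableSpace.comap (a s) inferInstance ⊔
      MeasurableSpace.comap (fun ω => loss ω s (a s ω)) inferInstance)

/-- The information of an outside observer at the beginning of round `t`: the whole loss sequence
(past and future, all arms) and the arms played in the earlier rounds. -/
@[reducible] def observerHistory {d T : ℕ} {Ω : Type*} (loss : Ω → Fin T → Fin d → ℝ)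
    (a : Fin T → Ω → Fin d) (t : Fin T) : MeasurableSpace Ω :=
  MeasurableSpace.comap loss inferInstance ⊔
    ⨆ s : Fin T, ⨆ _ : s < t, MeasurableSpace.comap (a s) inferInstance

/-- The posterior probability `p_t(i)`, given the player's information at the beginning of
round `t`, that `i` is the best arm `a* = s (loss)`. -/
noncomputable def posterior {d T : ℕ} {Ω : Type*} [MeasurableSpace Ω] (P : Measure Ω)
    (loss : Ω → Fin T → Fin d → ℝ) (a : Fin T → Ω → Fin d)
    (s : (Fin T → Fin d → ℝ) → Fin d) (t : Fin T) (i : Fin d) : Ω → ℝ :=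
  P[({ω | s (loss ω) = i} : Set Ω).indicator (fun _ => (1 : ℝ)) | banditHistory loss a t]

/-- The `γ`-thresholding of a probability vector `p`: the rare arms, those with `p i ≤ γ`, get
probability `0`, and the probabilities of the other arms are scaled up to sum to `1`. -/
noncomputable def thresholded {d : ℕ} (γ : ℝ) (p : Fin d → ℝ) (i : Fin d) : ℝ :=
  open Classical in
  if p i ≤ γ then 0 else p i / (1 - ∑ j ∈ Finset.univ.filter (fun j => p j ≤ γ), p j)

/-- On the probability space `(Ω, P)`, the arms `a` are played by Thompson Sampling with bandit
feedback, thresholded at `γ`, against the random loss sequence `loss`, whose law under `P` is the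
prior. The arm of round `t` is drawn with fresh randomness from the thresholded posterior: given
the whole loss sequence and the earlier arms, its conditional law is the thresholded posterior. -/
structure IsThresholdedThompson {d T : ℕ} {Ω : Type*} [MeasurableSpace Ω] (P : Measure Ω)
    (loss : Ω → Fin T → Fin d → ℝ) (s : (Fin T → Fin d → ℝ) → Fin d) (γ : ℝ)
    (a : Fin T → Ω → Fin d) : Prop where
  measurable : ∀ t, Measurable (a t)
  law : ∀ t i,
    P[({ω | a t ω = i} : Set Ω).indicator (fun _ => (1 : ℝ)) | observerHistory loss a t]
      =ᵐ[P] fun ω => thresholded γ (fun j => posterior P loss a s t j ω) i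

/-- The expected regret `E[R_T]`: expected loss of the player minus that of the best fixed arm. -/
noncomputable def expectedRegret {d T : ℕ} {Ω : Type*} [MeasurableSpace Ω] (P : Measure Ω)
    (loss : Ω → Fin T → Fin d → ℝ) (a : Fin T → Ω → Fin d) : ℝ :=
  ∫ ω, ((∑ t, loss ω t (a t ω)) - bestLoss (loss ω)) ∂P

/-! The regret splits over the arms, and each arm can be studied alone as an `ArmProcess`: the
coupling between arms enters only through `∑ B = 1` and the total loss `M` of the player. For one
arm, let `x` be its posterior and `u = √(x + γ)`. The importance-weighted observation of the arm is
known after round `t`, so against it the indicator `B` may be replaced by the next posterior; the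
non-rare regret is thus a correlation between the weighted loss and the increment of `x`. AM-GM
bounds it by `η` times a variance term of order `l √x` plus `1/η` times `(u - v)²/u`, where `v` is
the next root. Since `x` is a martingale, the latter has the mean of `2 (u - v)`, which telescopes
(`integral_regret_le`). A further AM-GM splits `l √x` into `κ l x`, which sums to at most `κ M`, and
`l / κ` on non-rare rounds. What keeps the bound free of `T` is that every arm suffers expected loss
`O(L)` while not rare (`integral_exposure_le`): if its estimated loss is far above `L`, the arm is
unlikely to be the best, yet in a non-rare round it is the best with probability above `γ`.
Rescaling the posterior costs at most `d γ M`. As `M ≤ L + R`, the result is a self-bounding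
inequality for the regret `R`, solved with `κ = √d` and `η` of order `1/√L`. -/

/-! ### Bounded test functions and conditional expectation -/

/-- Bounded functions that are measurable with respect to the σ-algebra `m`. -/
structure BddMeas {Ω : Type*} (m : MeasurableSpace Ω) (f : Ω → ℝ) : Prop where
  meas : Measurable[m] f
  bdd : ∃ C, ∀ ω, |f ω| ≤ C

namespace BddMeas

variable {Ω : Type*} {m m' : MeasurableSpace Ω} {f g : Ω → ℝ}

lemma mono (hf : BddMeas m f) (h : m ≤ m') : BddMeas m' f :=
  ⟨hf.meas.mono h le_rfl, hf.bdd⟩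

lemma const (c : ℝ) : BddMeas m (fun _ : Ω => c) :=
  ⟨measurable_const, |c|, fun _ => le_rfl⟩

lemma add (hf : BddMeas m f) (hg : BddMeas m g) : BddMeas m (fun ω => f ω + g ω) := by
  obtain ⟨C, hC⟩ := hf.bdd
  obtain ⟨D, hD⟩ := hg.bdd
  exact ⟨hf.meas.add hg.meas, C + D, fun ω => (abs_add_le _ _).trans (add_le_add (hC ω) (hD ω))⟩

lemma sub (hf : BddMeas m f) (hg : BddMeas m g) : BddMeas m (fun ω => f ω - g ω) := by
  obtain ⟨C, hC⟩ := hf.bdd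
  obtain ⟨D, hD⟩ := hg.bdd
  exact ⟨hf.meas.sub hg.meas, C + D, fun ω => (abs_sub _ _).trans (add_le_add (hC ω) (hD ω))⟩

lemma mul (hf : BddMeas m f) (hg : BddMeas m g) : BddMeas m (fun ω => f ω * g ω) := by
  obtain ⟨C, hC⟩ := hf.bdd
  obtain ⟨D, hD⟩ := hg.bdd
  refine ⟨hf.meas.mul hg.meas, C * D, fun ω => ?_⟩
  rw [abs_mul]
  exact mul_le_mul (hC ω) (hD ω) (abs_nonneg _) ((abs_nonneg _).trans (hC ω))

lemma sum {ι : Type*} {F : ι → Ω → ℝ} (s : Finset ι) (h : ∀ i ∈ s, BddMeas m (F i)) :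
    BddMeas m (fun ω => ∑ i ∈ s, F i ω) := by
  classical
  induction s using Finset.induction_on with
  | empty => simpa using const 0
  | insert a s ha ih =>
    simp only [Finset.sum_insert ha]
    exact (h a (Finset.mem_insert_self _ _)).add
      (ih fun i hi => h i (Finset.mem_insert_of_mem hi))

lemma exp (hf : BddMeas m f) : BddMeas m (fun ω => Real.exp (f ω)) := by
  obtain ⟨C, hC⟩ := hf.bdd
  refine ⟨hf.meas.exp, Real.exp C, fun ω => ?_⟩
  rw [Real.abs_exp]
  exact Real.exp_le_exp.2 ((le_abs_self _).trans (hC ω))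

lemma sqrt (hf : BddMeas m f) : BddMeas m (fun ω => √(f ω)) := by
  obtain ⟨C, hC⟩ := hf.bdd
  refine ⟨hf.meas.sqrt, √C, fun ω => ?_⟩
  rw [abs_of_nonneg (Real.sqrt_nonneg _)]
  exact Real.sqrt_le_sqrt ((le_abs_self _).trans (hC ω))

lemma of_mem_Icc {a b : ℝ} (hf : Measurable[m] f) (h : ∀ ω, f ω ∈ Icc a b) : BddMeas m f :=
  ⟨hf, max |a| |b|, fun ω => abs_le_max_abs_abs (h ω).1 (h ω).2⟩

lemma integrable [MeasurableSpace Ω] {P : Measure Ω} [IsFiniteMeasure P]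
    (hf : BddMeas ‹MeasurableSpace Ω› f) : Integrable f P := by
  obtain ⟨C, hC⟩ := hf.bdd
  exact Integrable.of_bound hf.meas.aestronglyMeasurable C (ae_of_all _ hC)

end BddMeas

/-- A conditional expectation may be replaced when testing against bounded functions. -/
lemma integral_mul_eq_of_condExp_ae_eq {Ω : Type*} {m m0 : MeasurableSpace Ω} {P : Measure Ω}
    [IsProbabilityMeasure P] (hm : m ≤ m0) {f g h : Ω → ℝ} (hf : BddMeas m f)
    (hg : BddMeas m0 g) (hh : P[g | m] =ᵐ[P] h) :
    ∫ ω, f ω * g ω ∂P = ∫ ω, f ω * h ω ∂P := by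
  have h1 : P[f * g | m] =ᵐ[P] f * P[g | m] :=
    condExp_mul_of_stronglyMeasurable_left hf.meas.stronglyMeasurable
      ((hf.mono hm).mul hg).integrable hg.integrable
  calc ∫ ω, f ω * g ω ∂P = ∫ ω, (P[f * g | m]) ω ∂P := (integral_condExp hm).symm
    _ = ∫ ω, f ω * h ω ∂P := by
      refine integral_congr_ae ?_
      filter_upwards [h1, hh] with ω h1 h2
      rw [h1, Pi.mul_apply, h2]

/-! ### The process of a single arm -/

/-- One arm of a Bayesian bandit. `H t` and `G t` are the informations of the player and of the
observer before round `t`, `B` indicates that the arm is the best one, `x t` is the posterior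
probability of this, `q t` the probability to play the arm in round `t`, `A t` indicates that it is
played, and `l t` is its loss. Arms with `x t ≤ γ` are not played. -/
structure ArmProcess {Ω : Type*} [m0 : MeasurableSpace Ω] (P : Measure Ω) (T : ℕ) (γ : ℝ)
    (H G : ℕ → MeasurableSpace Ω) (l x q A : ℕ → Ω → ℝ) (B : Ω → ℝ) : Prop where
  H_mono : Monotone H
  H_le_G : ∀ t, H t ≤ G t
  G_le : ∀ t, G t ≤ m0
  γ_pos : 0 < γ
  l_meas : ∀ s t, Measurable[G t] (l s)
  l_mem : ∀ t ω, l t ω ∈ Icc (0 : ℝ) 1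
  x_meas : ∀ t, Measurable[H t] (x t)
  x_mem : ∀ t ω, x t ω ∈ Icc (0 : ℝ) 1
  q_meas : ∀ t, Measurable[H t] (q t)
  q_mem : ∀ t ω, q t ω ∈ Icc (0 : ℝ) 2
  le_q : ∀ t ω, γ < x t ω → x t ω ≤ q t ω
  A_meas : ∀ t, Measurable[H (t + 1)] (A t)
  A_mem : ∀ t ω, A t ω = 0 ∨ A t ω = 1
  Al_meas : ∀ t, Measurable[H (t + 1)] (fun ω => A t ω * l t ω)
  B_meas : ∀ t, Measurable[G t] B
  B_mem : ∀ ω, B ω = 0 ∨ B ω = 1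
  -- The case `t = T` is included because the last round compares `x (T - 1)` with `x T`.
  law_B : ∀ t ≤ T, ∀ f, BddMeas (H t) f → ∫ ω, f ω * B ω ∂P = ∫ ω, f ω * x t ω ∂P
  law_A : ∀ t < T, ∀ f, BddMeas (G t) f → ∫ ω, f ω * A t ω ∂P = ∫ ω, f ω * q t ω ∂P

namespace ArmProcess

open Classical in
/-- Indicator of `γ < x`. -/
noncomputable def frequent {Ω : Type*} (γ : ℝ) (x : Ω → ℝ) (ω : Ω) : ℝ :=
  if γ < x ω then 1 else 0

lemma frequent_mem {Ω : Type*} (γ : ℝ) (x : Ω → ℝ) (ω : Ω) :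
    frequent γ x ω = 0 ∨ frequent γ x ω = 1 := by
  unfold frequent
  split_ifs <;> simp

variable {Ω : Type*} [m0 : MeasurableSpace Ω] {P : Measure Ω} [IsProbabilityMeasure P] {T : ℕ}
  {γ : ℝ} {H G : ℕ → MeasurableSpace Ω} {l x q A : ℕ → Ω → ℝ} {B : Ω → ℝ}

section basic

variable (h : ArmProcess P T γ H G l x q A B)
include h

omit [IsProbabilityMeasure P]

lemma H_le (t : ℕ) : H t ≤ m0 := (h.H_le_G t).trans (h.G_le t)

lemma bdd_l (s t : ℕ) : BddMeas (G t) (l s) := .of_mem_Icc (h.l_meas s t) (h.l_mem s)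

lemma bdd_x (t : ℕ) : BddMeas (H t) (x t) := .of_mem_Icc (h.x_meas t) (h.x_mem t)

lemma bdd_q (t : ℕ) : BddMeas (H t) (q t) := .of_mem_Icc (h.q_meas t) (h.q_mem t)

lemma A_mem_Icc (t : ℕ) (ω : Ω) : A t ω ∈ Icc (0 : ℝ) 1 := by
  rcases h.A_mem t ω with h | h <;> simp [h]

lemma bdd_A (t : ℕ) : BddMeas (H (t + 1)) (A t) := .of_mem_Icc (h.A_meas t) (h.A_mem_Icc t)

lemma bdd_Al (t : ℕ) : BddMeas (H (t + 1)) (fun ω => A t ω * l t ω) :=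
  .of_mem_Icc (h.Al_meas t) fun ω => unitInterval.mul_mem (h.A_mem_Icc t ω) (h.l_mem t ω)

lemma bdd_B (t : ℕ) : BddMeas (G t) B :=
  .of_mem_Icc (h.B_meas t) (a := 0) (b := 1) fun ω => by
    rcases h.B_mem ω with h | h <;> simp [h]

lemma bdd_frequent (t : ℕ) : BddMeas (H t) (frequent γ (x t)) := by
  refine .of_mem_Icc (a := 0) (b := 1) ?_ fun ω => ?_
  · exact Measurable.ite (measurableSet_lt measurable_const (h.x_meas t)) measurable_const
      measurable_const
  · unfold frequent
    split_ifs <;> simp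

/-- The inverse propensity weight on the rounds in which the arm is not rare. -/
lemma weight_mem (t : ℕ) (ω : Ω) : frequent γ (x t) ω / q t ω ∈ Icc (0 : ℝ) (1 / γ) := by
  have hγ := h.γ_pos
  unfold frequent
  split_ifs with hx
  · have := h.le_q t ω hx
    have hq : γ ≤ q t ω := hx.le.trans this
    exact ⟨by have := hγ.trans_le hq; positivity, one_div_le_one_div_of_le hγ hq⟩
  · simp [hγ.le]

lemma bdd_weight (t : ℕ) : BddMeas (H t) (fun ω => frequent γ (x t) ω / q t ω) :=
  .of_mem_Icc ((h.bdd_frequent t).meas.div (h.q_meas t)) (h.weight_mem t)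

lemma weight_mul (t : ℕ) (ω : Ω) :
    frequent γ (x t) ω / q t ω * q t ω = frequent γ (x t) ω := by
  have hγ := h.γ_pos
  unfold frequent
  split_ifs with hx
  · have := h.le_q t ω hx
    exact div_mul_cancel₀ _ (by linarith)
  · simp

end basic

/-! ### Loss of an arm in its non-rare rounds -/

/-- The inverse propensity estimate of the loss in the non-rare rounds before `t`. -/
noncomputable def estimate (γ : ℝ) (l x q A : ℕ → Ω → ℝ) (t : ℕ) (ω : Ω) : ℝ :=
  ∑ s ∈ Finset.range t, frequent γ (x s) ω / q s ω * (A s ω * l s ω)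

/-- The loss in the non-rare rounds before `t`. -/
noncomputable def exposure (γ : ℝ) (l x : ℕ → Ω → ℝ) (t : ℕ) (ω : Ω) : ℝ :=
  ∑ s ∈ Finset.range t, frequent γ (x s) ω * l s ω

/-- The value `exp (γ (Ŝ - K))` of the estimate `Ŝ` at the beginning of the last non-rare round. -/
noncomputable def record (γ K : ℝ) (l x q A : ℕ → Ω → ℝ) : ℕ → Ω → ℝ
  | 0, _ => 0
  | t + 1, ω => record γ K l x q A t ω + frequent γ (x t) ω *
      (Real.exp (γ * (estimate γ l x q A t ω - K)) - record γ K l x q A t ω)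

section exposure

variable (h : ArmProcess P T γ H G l x q A B)
include h

omit [IsProbabilityMeasure P] in
lemma bdd_estimate (t : ℕ) : BddMeas (H t) (estimate γ l x q A t) :=
  .sum _ fun s hs => ((h.bdd_weight s).mono (h.H_mono (Finset.mem_range.1 hs).le)).mul
    ((h.bdd_Al s).mono (h.H_mono (Finset.mem_range.1 hs)))

omit [IsProbabilityMeasure P] in
lemma bdd_exposure (t : ℕ) : BddMeas (G t) (exposure γ l x t) :=
  .sum _ fun s hs => ((h.bdd_frequent s).mono
    ((h.H_mono (Finset.mem_range.1 hs).le).trans (h.H_le_G t))).mul (h.bdd_l s t)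

-- The arm is drawn with fresh randomness, so `A t` averages to `q t` against anything the observer
-- knows, and the weight cancels `q t`.
omit [IsProbabilityMeasure P] in
lemma integral_weight_mul {t : ℕ} (ht : t < T) {f : Ω → ℝ} (hf : BddMeas (G t) f) :
    ∫ ω, f ω * (frequent γ (x t) ω / q t ω) * A t ω ∂P = ∫ ω, f ω * frequent γ (x t) ω ∂P := by
  rw [h.law_A t ht _ (hf.mul ((h.bdd_weight t).mono (h.H_le_G t)))]
  simp only [mul_assoc, h.weight_mul t]

lemma integral_estimate {t : ℕ} (ht : t ≤ T) :
    ∫ ω, estimate γ l x q A t ω ∂P = ∫ ω, exposure γ l x t ω ∂P := by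
  unfold estimate exposure
  rw [integral_finsetSum, integral_finsetSum]
  · refine Finset.sum_congr rfl fun s hs => ?_
    have := h.integral_weight_mul ((Finset.mem_range.1 hs).trans_le ht) (h.bdd_l s s)
    rw [← integral_congr_ae (ae_of_all _ fun ω => mul_comm (l s ω) (frequent γ (x s) ω)), ← this]
    refine integral_congr_ae (ae_of_all _ fun ω => ?_)
    simp only
    ring
  · exact fun s _ => (((h.bdd_frequent s).mono (h.H_le s)).mul
      ((h.bdd_l s s).mono (h.G_le s))).integrable
  · exact fun s _ => (((h.bdd_weight s).mono (h.H_le s)).mul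
      ((h.bdd_Al s).mono (h.H_le _))).integrable

/-- The exponential is a supermartingale: the drift `2γ` per unit of true loss outweighs the
exponential growth of the unbiased estimate. -/
lemma integral_exp_le_one {t : ℕ} (ht : t ≤ T) :
    ∫ ω, Real.exp (γ * estimate γ l x q A t ω - 2 * γ * exposure γ l x t ω) ∂P ≤ 1 := by
  induction t with
  | zero => simp [estimate, exposure]
  | succ t ih =>
    have hγ := h.γ_pos
    set F : Ω → ℝ := fun ω =>
      Real.exp (γ * estimate γ l x q A t ω - 2 * γ * exposure γ l x t ω) with hF
    have bF : BddMeas (G t) F := ((((BddMeas.const γ).mul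
      ((h.bdd_estimate t).mono (h.H_le_G t))).sub
      ((BddMeas.const (2 * γ)).mul (h.bdd_exposure t)))).exp
    have bN := (h.bdd_frequent t).mono (h.H_le_G t)
    have bW := (h.bdd_weight t).mono (h.H_le_G t)
    set E : Ω → ℝ := fun ω => F ω * Real.exp ((-2 * γ) * (frequent γ (x t) ω * l t ω)) with hE
    have bE : BddMeas (G t) E :=
      bF.mul ((BddMeas.const (-2 * γ)).mul (bN.mul (h.bdd_l t t))).exp
    have bEl : BddMeas (G t) (fun ω => 2 * γ * (E ω * l t ω)) :=
      (BddMeas.const (2 * γ)).mul (bE.mul (h.bdd_l t t))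
    have bA := (h.bdd_A t).mono (h.H_le _)
    have key := h.integral_weight_mul (Nat.lt_of_succ_le ht) bEl
    have iE : Integrable E P := (bE.mono (h.G_le t)).integrable
    have i1 : Integrable (fun ω => 2 * γ * (E ω * l t ω) *
        (frequent γ (x t) ω / q t ω) * A t ω) P :=
      (((bEl.mul bW).mono (h.G_le t)).mul bA).integrable
    have i2 : Integrable (fun ω => 2 * γ * (E ω * l t ω) * frequent γ (x t) ω) P :=
      ((bEl.mul bN).mono (h.G_le t)).integrable
    have bS : BddMeas m0 (fun ω => Real.exp (γ * estimate γ l x q A (t + 1) ω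
        - 2 * γ * exposure γ l x (t + 1) ω)) :=
      (((BddMeas.const γ).mul ((h.bdd_estimate _).mono (h.H_le _))).sub
        ((BddMeas.const (2 * γ)).mul ((h.bdd_exposure _).mono (h.G_le _)))).exp
    calc _ ≤ ∫ ω, (E ω + 2 * γ * (E ω * l t ω) *
          (frequent γ (x t) ω / q t ω) * A t ω) ∂P := by
          refine integral_mono bS.integrable (iE.add i1) fun ω => ?_
          have hw := h.weight_mem t ω
          have hA := h.A_mem_Icc t ω
          have hl := h.l_mem t ω
          set w := frequent γ (x t) ω / q t ω with hw_def
          have hy0 : 0 ≤ γ * (w * (A t ω * l t ω)) := by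
            have := hw.1; have := hA.1; have := hl.1; positivity
          -- Weights are at most `1 / γ`, so the exponent stays in `[0, 1]`, where `exp y ≤ 1 + 2
          -- y`.
          have hy1 : γ * (w * (A t ω * l t ω)) ≤ 1 := by
            have h1 : A t ω * l t ω ≤ 1 := mul_le_one₀ hA.2 hl.1 hl.2
            have h2 : w * (A t ω * l t ω) ≤ 1 / γ :=
              (mul_le_of_le_one_right hw.1 h1).trans hw.2
            calc _ ≤ γ * (1 / γ) := by gcongr
              _ = 1 := by field_simp
          have hexp : Real.exp (γ * (w * (A t ω * l t ω))) ≤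
              1 + 2 * (γ * (w * (A t ω * l t ω))) := by
            have := Real.abs_exp_sub_one_le (x := γ * (w * (A t ω * l t ω)))
              (by rwa [abs_of_nonneg hy0])
            rw [abs_of_nonneg hy0] at this
            linarith [(abs_le.1 this).2]
          have hsplit : Real.exp (γ * estimate γ l x q A (t + 1) ω
              - 2 * γ * exposure γ l x (t + 1) ω) =
              E ω * Real.exp (γ * (w * (A t ω * l t ω))) := by
            simp only [hE, hF, estimate, exposure, Finset.sum_range_succ, ← Real.exp_add]
            congr 1
            rw [hw_def]
            ring
          have hE0 : 0 ≤ E ω := by simp only [hE, hF]; positivity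
          simp only [hsplit]
          calc _ ≤ E ω * (1 + 2 * (γ * (w * (A t ω * l t ω)))) :=
                mul_le_mul_of_nonneg_left hexp hE0
            _ = _ := by ring
      _ = ∫ ω, (E ω + 2 * γ * (E ω * l t ω) * frequent γ (x t) ω) ∂P := by
          rw [integral_add iE i1, key, ← integral_add iE i2]
      _ ≤ ∫ ω, F ω ∂P := by
          refine integral_mono (iE.add i2) (bF.mono (h.G_le t)).integrable fun ω => ?_
          have hF0 : 0 ≤ F ω := by simp only [hF]; positivity
          set y := 2 * γ * (frequent γ (x t) ω * l t ω) with hy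
          have h1 : E ω = F ω * Real.exp (-y) := by
            simp only [hE, hy]; congr 2; ring
          have h2 : (y + 1) * Real.exp (-y) ≤ 1 := by
            calc _ ≤ Real.exp y * Real.exp (-y) := by gcongr; exact Real.add_one_le_exp y
              _ = 1 := by rw [← Real.exp_add]; simp
          calc _ = F ω * ((y + 1) * Real.exp (-y)) := by simp only [h1, hy]; ring
            _ ≤ F ω := mul_le_of_le_one_right hF0 h2
      _ ≤ 1 := ih (by omega)

omit [IsProbabilityMeasure P] in
lemma estimate_le_succ (t : ℕ) (ω : Ω) : estimate γ l x q A t ω ≤ estimate γ l x q A (t + 1) ω := by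
  simp only [estimate, Finset.sum_range_succ]
  have := mul_nonneg (h.weight_mem t ω).1 (mul_nonneg (h.A_mem_Icc t ω).1 (h.l_mem t ω).1)
  linarith

omit [IsProbabilityMeasure P] in
lemma record_mem (K : ℝ) (t : ℕ) (ω : Ω) :
    record γ K l x q A t ω ∈ Icc 0 (Real.exp (γ * (estimate γ l x q A t ω - K))) := by
  have hγ := h.γ_pos
  induction t with
  | zero => simp [record, Real.exp_nonneg]
  | succ t ih =>
    have h1 : Real.exp (γ * (estimate γ l x q A t ω - K)) ≤
        Real.exp (γ * (estimate γ l x q A (t + 1) ω - K)) := by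
      have := h.estimate_le_succ t ω
      gcongr
    rcases frequent_mem γ (x t) ω with hN | hN
    · simpa [record, hN] using ⟨ih.1, ih.2.trans h1⟩
    · simp only [record, hN, one_mul, add_sub_cancel]
      exact ⟨Real.exp_nonneg _, h1⟩

-- Since the last non-rare round began, the estimate has grown by at most `1 / γ`, which costs the
-- `1`; the rest is `y + 1 ≤ exp y`.
omit [IsProbabilityMeasure P] in
lemma estimate_le_record {K : ℝ} (hK : 0 ≤ K) (t : ℕ) (ω : Ω) :
    γ * (estimate γ l x q A t ω - K) - 1 ≤ record γ K l x q A t ω := by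
  have hγ := h.γ_pos
  induction t with
  | zero =>
    simp only [estimate, Finset.sum_range_zero, record]
    nlinarith
  | succ t ih =>
    rcases frequent_mem γ (x t) ω with hN | hN
    · simpa [record, estimate, Finset.sum_range_succ, hN] using ih
    · have hs : estimate γ l x q A (t + 1) ω ≤ estimate γ l x q A t ω + 1 / γ := by
        simp only [estimate, Finset.sum_range_succ]
        gcongr
        have hw := h.weight_mem t ω
        exact (mul_le_of_le_one_right hw.1
          (mul_le_one₀ (h.A_mem_Icc t ω).2 (h.l_mem t ω).1 (h.l_mem t ω).2)).trans hw.2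
      have h2 : γ * (estimate γ l x q A (t + 1) ω - K) - 1 ≤
          γ * (estimate γ l x q A t ω - K) := by
        have := mul_le_mul_of_nonneg_left hs hγ.le
        rw [mul_add, mul_one_div_cancel hγ.ne'] at this
        linarith
      simp only [record, hN]
      linarith [Real.add_one_le_exp (γ * (estimate γ l x q A t ω - K))]

omit [IsProbabilityMeasure P] in
lemma bdd_record (K : ℝ) (t : ℕ) : BddMeas (H t) (record γ K l x q A t) := by
  induction t with
  | zero => exact .const 0
  | succ t ih =>
    refine BddMeas.mono (m := H t) ?_ (h.H_mono t.le_succ)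
    exact ih.add ((h.bdd_frequent t).mul
      ((((BddMeas.const γ).mul ((h.bdd_estimate t).sub (.const K))).exp).sub ih))

/-- The record increases only in non-rare rounds, and each increment is known to the player at a
time when the arm is the best with probability above `γ`. -/
lemma integral_record_le (K : ℝ) {t : ℕ} (ht : t ≤ T) :
    γ * ∫ ω, record γ K l x q A t ω ∂P ≤ ∫ ω, record γ K l x q A t ω * B ω ∂P := by
  induction t with
  | zero => simp [record]
  | succ t ih =>
    have bR := h.bdd_record K t
    set D : Ω → ℝ := fun ω => frequent γ (x t) ω *
      (Real.exp (γ * (estimate γ l x q A t ω - K)) - record γ K l x q A t ω) with hD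
    have bD : BddMeas (H t) D := (h.bdd_frequent t).mul
      ((((BddMeas.const γ).mul ((h.bdd_estimate t).sub (.const K))).exp).sub bR)
    have hle := h.H_le t
    have bB := (h.bdd_B t).mono (h.G_le t)
    have e1 : ∀ ω, record γ K l x q A (t + 1) ω = record γ K l x q A t ω + D ω := fun ω => rfl
    simp only [e1, add_mul]
    rw [integral_add (bR.mono hle).integrable (bD.mono hle).integrable,
      integral_add ((bR.mono hle).mul bB).integrable ((bD.mono hle).mul bB).integrable, mul_add]
    refine add_le_add (ih (by omega)) ?_
    rw [h.law_B t (by omega) D bD, ← integral_const_mul]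
    refine integral_mono ((BddMeas.const γ).mul (bD.mono hle)).integrable
      ((bD.mul (h.bdd_x t)).mono hle).integrable fun ω => ?_
    have h0 := (h.record_mem K t ω).2
    simp only [hD, frequent]
    split_ifs with hx
    · nlinarith
    · simp

/-- Before an arm becomes rare for good, it has suffered only a moderate loss. -/
lemma integral_exposure_le {L : ℝ} (hL : 0 ≤ L)
    (hBL : ∀ᵐ ω ∂P, B ω = 1 → ∑ t ∈ Finset.range T, l t ω ≤ L) :
    ∫ ω, exposure γ l x T ω ∂P ≤ 1 / γ + 4 * L + Real.exp (-2 * γ * L) / γ ^ 2 := by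
  have hγ := h.γ_pos
  -- If the arm is the best, its exposure `S` is at most `L`, so `K = 4 L` gives `γ (Ŝ - K) ≤ -2γL +
  -- (γ Ŝ - 2γ S)`, and the supermartingale bound applies.
  set K := 4 * L with hK
  have bR := (h.bdd_record K T).mono (h.H_le T)
  have bB := (h.bdd_B T).mono (h.G_le T)
  have bE := (h.bdd_estimate T).mono (h.H_le T)
  have bS := (h.bdd_exposure T).mono (h.G_le T)
  have bX : BddMeas m0 (fun ω => Real.exp (γ * estimate γ l x q A T ω
      - 2 * γ * exposure γ l x T ω)) :=
    (((BddMeas.const γ).mul bE).sub ((BddMeas.const (2 * γ)).mul bS)).exp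
  have h1 : ∫ ω, record γ K l x q A T ω * B ω ∂P ≤ Real.exp (-2 * γ * L) := by
    calc _ ≤ ∫ ω, Real.exp (-2 * γ * L) * Real.exp (γ * estimate γ l x q A T ω
          - 2 * γ * exposure γ l x T ω) ∂P := by
          refine integral_mono_ae (bR.mul bB).integrable ((BddMeas.const _).mul bX).integrable ?_
          filter_upwards [hBL] with ω hω
          rcases h.B_mem ω with hB | hB
          · rw [hB, mul_zero]; positivity
          · rw [hB, mul_one, ← Real.exp_add]
            refine (h.record_mem K T ω).2.trans (Real.exp_le_exp.2 ?_)
            have h3 : exposure γ l x T ω ≤ L := by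
              refine le_trans (Finset.sum_le_sum fun s _ => ?_) (hω hB)
              rcases frequent_mem γ (x s) ω with hN | hN <;> simp [hN, (h.l_mem s ω).1]
            rw [hK]
            nlinarith
      _ ≤ Real.exp (-2 * γ * L) := by
          rw [integral_const_mul]
          exact mul_le_of_le_one_right (Real.exp_nonneg _) (h.integral_exp_le_one le_rfl)
  have h2 := h.integral_record_le K le_rfl
  have h3 : ∫ ω, (γ * (estimate γ l x q A T ω - K) - 1) ∂P ≤ ∫ ω, record γ K l x q A T ω ∂P :=
    integral_mono (((BddMeas.const γ).mul (bE.sub (.const K))).sub (.const 1)).integrable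
      bR.integrable fun ω => h.estimate_le_record (by positivity) T ω
  rw [integral_sub ((BddMeas.const γ).mul (bE.sub (.const K))).integrable (integrable_const _),
    integral_const_mul, integral_sub bE.integrable (integrable_const _),
    h.integral_estimate le_rfl] at h3
  simp only [integral_const, probReal_univ, smul_eq_mul, one_mul] at h3
  set S := ∫ ω, exposure γ l x T ω ∂P
  have h4 : γ * (γ * (S - K) - 1) ≤ Real.exp (-2 * γ * L) :=
    (mul_le_mul_of_nonneg_left h3 hγ.le).trans (h2.trans h1)
  have h5 : S - K - 1 / γ ≤ Real.exp (-2 * γ * L) / γ ^ 2 := by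
    rw [le_div_iff₀ (by positivity)]
    calc _ = γ * (γ * (S - K) - 1) := by field_simp
      _ ≤ _ := h4
  linarith

end exposure

/-! ### Information gain through the root potential -/

section information

variable (h : ArmProcess P T γ H G l x q A B)
include h

omit [IsProbabilityMeasure P] in
lemma root_pos (t : ℕ) (ω : Ω) : 0 < √(x t ω + γ) :=
  Real.sqrt_pos.2 (add_pos_of_nonneg_of_pos (h.x_mem t ω).1 h.γ_pos)

omit [IsProbabilityMeasure P] in
lemma bdd_root (t : ℕ) : BddMeas (H t) (fun ω => √(x t ω + γ)) :=
  ((h.bdd_x t).add (.const γ)).sqrt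

omit [IsProbabilityMeasure P] in
lemma bdd_root_inv (t : ℕ) : BddMeas (H t) (fun ω => (√(x t ω + γ))⁻¹) := by
  refine .of_mem_Icc (a := 0) (b := (√γ)⁻¹) (h.bdd_root t).meas.inv fun ω =>
    ⟨inv_nonneg.2 (Real.sqrt_nonneg _), ?_⟩
  exact inv_anti₀ (Real.sqrt_pos.2 h.γ_pos) (Real.sqrt_le_sqrt (by linarith [(h.x_mem t ω).1]))

omit [IsProbabilityMeasure P] in
/-- The posterior is a martingale. -/
lemma integral_mul_succ {t : ℕ} (ht : t < T) {f : Ω → ℝ} (hf : BddMeas (H t) f) :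
    ∫ ω, f ω * x (t + 1) ω ∂P = ∫ ω, f ω * x t ω ∂P := by
  rw [← h.law_B t ht.le f hf, ← h.law_B (t + 1) ht f (hf.mono (h.H_mono t.le_succ))]

/-- The squared increments of the root potential are paid by its decrease. -/
lemma integral_root_sq {t : ℕ} (ht : t < T) :
    ∫ ω, (√(x t ω + γ) - √(x (t + 1) ω + γ)) ^ 2 * (√(x t ω + γ))⁻¹ ∂P =
      2 * (∫ ω, √(x t ω + γ) ∂P - ∫ ω, √(x (t + 1) ω + γ) ∂P) := by
  have hle := h.H_le t
  have hle' := h.H_le (t + 1)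
  have bu := (h.bdd_root t).mono hle
  have bu' := (h.bdd_root (t + 1)).mono hle'
  have bi := (h.bdd_root_inv t).mono hle
  have bx := (h.bdd_x t).mono hle
  have bx' := (h.bdd_x (t + 1)).mono hle'
  have key := h.integral_mul_succ ht (h.bdd_root_inv t)
  -- This is `(u - v)² / u = 2 (u - v) + (v² - u²) / u`. Here `v² - u²` is the increment of the
  -- posterior, which has mean zero against `1 / u`.
  have e : ∀ ω, (√(x t ω + γ) - √(x (t + 1) ω + γ)) ^ 2 * (√(x t ω + γ))⁻¹ =
      2 * (√(x t ω + γ) - √(x (t + 1) ω + γ)) +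
        ((√(x t ω + γ))⁻¹ * x (t + 1) ω - (√(x t ω + γ))⁻¹ * x t ω) := by
    intro ω
    have h0 := h.root_pos t ω
    have h1 : √(x t ω + γ) ^ 2 = x t ω + γ :=
      Real.sq_sqrt (by linarith [(h.x_mem t ω).1, h.γ_pos])
    have h2 : √(x (t + 1) ω + γ) ^ 2 = x (t + 1) ω + γ :=
      Real.sq_sqrt (by linarith [(h.x_mem (t + 1) ω).1, h.γ_pos])
    have h3 : x t ω = √(x t ω + γ) ^ 2 - γ := by linarith
    have h4 : x (t + 1) ω = √(x (t + 1) ω + γ) ^ 2 - γ := by linarith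
    generalize √(x t ω + γ) = u at *
    generalize √(x (t + 1) ω + γ) = v at *
    rw [h3, h4]
    field_simp
    ring
  simp only [e]
  rw [integral_add ((BddMeas.const 2).mul (bu.sub bu')).integrable
      ((bi.mul bx').sub (bi.mul bx)).integrable, integral_const_mul,
    integral_sub bu.integrable bu'.integrable,
    integral_sub (bi.mul bx').integrable (bi.mul bx).integrable, key]
  ring

/-- The regret due to one arm in one round is controlled by its loss and by the information
gained. -/
lemma integral_regret_le {η : ℝ} (hη : 0 < η) {t : ℕ} (ht : t < T) :
    ∫ ω, frequent γ (x t) ω * l t ω * (x t ω - B ω) ∂P ≤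
      3 * η * ∫ ω, frequent γ (x t) ω * l t ω * √(x t ω) ∂P +
        2 / η * (∫ ω, √(x t ω + γ) ∂P - ∫ ω, √(x (t + 1) ω + γ) ∂P) := by
  have hγ := h.γ_pos
  have hle := h.H_le t
  have hle' := h.H_le (t + 1)
  have hG := h.G_le t
  have hHG := h.H_le_G t
  have bu := h.bdd_root t
  have bu' := h.bdd_root (t + 1)
  have bi := h.bdd_root_inv t
  have bx := h.bdd_x t
  have bx' := h.bdd_x (t + 1)
  have bN := h.bdd_frequent t
  have bW := h.bdd_weight t
  have bl := h.bdd_l t t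
  have bB := h.bdd_B t
  have bA := h.bdd_A t
  have bAl := h.bdd_Al t
  have hsucc := h.H_mono t.le_succ
  set u : Ω → ℝ := fun ω => √(x t ω + γ) with hu
  set v : Ω → ℝ := fun ω => √(x (t + 1) ω + γ) with hv
  set w : Ω → ℝ := fun ω => frequent γ (x t) ω / q t ω with hw
  have bF : BddMeas (H (t + 1)) (fun ω => w ω * (A t ω * l t ω)) := (bW.mono hsucc).mul bAl
  -- Weighting by `w A` turns the loss into a quantity observed by time `t + 1`; the law of `B` at
  -- that time then replaces `B` by `x (t + 1)`.
  have s1 : ∫ ω, frequent γ (x t) ω * l t ω * (x t ω - B ω) ∂P =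
      ∫ ω, w ω * (A t ω * l t ω) * (x t ω - x (t + 1) ω) ∂P := by
    have e1 := h.integral_weight_mul ht (bl.mul ((bx.mono hHG).sub bB))
    have e2 := h.law_B (t + 1) ht _ bF
    have e3 : ∫ ω, w ω * (A t ω * l t ω) * (x t ω - B ω) ∂P =
        ∫ ω, w ω * (A t ω * l t ω) * (x t ω - x (t + 1) ω) ∂P := by
      simp only [mul_sub]
      rw [integral_sub, integral_sub, e2]
      · exact ((bF.mul (bx.mono hsucc)).mono hle').integrable
      · exact ((bF.mul bx').mono hle').integrable
      · exact ((bF.mul (bx.mono hsucc)).mono hle').integrable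
      · exact ((bF.mono hle').mul (bB.mono hG)).integrable
    rw [← e3]
    refine Eq.trans (integral_congr_ae (ae_of_all _ fun ω => ?_))
      (e1.symm.trans (integral_congr_ae (ae_of_all _ fun ω => ?_)))
    · simp only; ring
    · simp only [hw]; ring
  have bV : BddMeas (G t) (fun ω => w ω * (l t ω * l t ω * (u ω * u ω * u ω))) :=
    (bW.mono hHG).mul ((bl.mul bl).mul (((bu.mul bu).mul bu).mono hHG))
  have i1 : BddMeas m0 (fun ω => w ω * (l t ω * l t ω * (u ω * u ω * u ω)) * w ω * A t ω) :=
    ((bV.mul (bW.mono hHG)).mono hG).mul (bA.mono hle')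
  have i2 : BddMeas m0 (fun ω => (u ω - v ω) ^ 2 * (u ω)⁻¹) := by
    simp only [pow_two]
    exact ((((bu.mono hsucc).sub bu').mul ((bu.mono hsucc).sub bu')).mul
      (bi.mono hsucc)).mono hle'
  have s2 : ∫ ω, w ω * (A t ω * l t ω) * (x t ω - x (t + 1) ω) ∂P ≤
      ∫ ω, (η * (w ω * (l t ω * l t ω * (u ω * u ω * u ω)) * w ω * A t ω) +
        1 / η * ((u ω - v ω) ^ 2 * (u ω)⁻¹)) ∂P := by
    refine integral_mono ((bF.mul ((bx.mono hsucc).sub bx')).mono hle').integrable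
      (((BddMeas.const η).mul i1).add ((BddMeas.const (1 / η)).mul i2)).integrable fun ω => ?_
    have hu0 : 0 < u ω := h.root_pos t ω
    have hu2 : u ω ^ 2 = x t ω + γ := Real.sq_sqrt (by linarith [(h.x_mem t ω).1])
    have hv2 : v ω ^ 2 = x (t + 1) ω + γ := Real.sq_sqrt (by linarith [(h.x_mem (t + 1) ω).1])
    have hw0 : 0 ≤ w ω := (h.weight_mem t ω).1
    have hl0 := (h.l_mem t ω).1
    simp only
    rcases h.A_mem t ω with hA | hA
    · rw [hA]
      have : 0 ≤ 1 / η * ((u ω - v ω) ^ 2 * (u ω)⁻¹) := by positivity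
      simpa using this
    · rw [hA]
      have h1 : x t ω - x (t + 1) ω ≤ 2 * u ω * (u ω - v ω) := by
        nlinarith [sq_nonneg (u ω - v ω)]
      have h2 : w ω * (1 * l t ω) * (x t ω - x (t + 1) ω) ≤
          w ω * (1 * l t ω) * (2 * u ω * (u ω - v ω)) := by gcongr
      refine h2.trans (sub_nonneg.1 ?_)
      -- AM-GM by completing the square; the bound `u² - v² ≤ 2u (u - v)` has made the increment
      -- linear in `u - v`.
      have : η * (w ω * (l t ω * l t ω * (u ω * u ω * u ω)) * w ω * 1) +
          1 / η * ((u ω - v ω) ^ 2 * (u ω)⁻¹) - w ω * (1 * l t ω) * (2 * u ω * (u ω - v ω)) =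
          (η * (w ω * l t ω * u ω ^ 2) - (u ω - v ω)) ^ 2 / (η * u ω) := by
        field_simp
        ring
      rw [this]
      positivity
  -- Averaging over `A` cancels one of the two weights; the other is `1 / q ≤ 1 / x`, and `u³ ≤ 3 x
  -- √x` because `γ < x`.
  have s3 : ∫ ω, w ω * (l t ω * l t ω * (u ω * u ω * u ω)) * w ω * A t ω ∂P ≤
      3 * ∫ ω, frequent γ (x t) ω * l t ω * √(x t ω) ∂P := by
    rw [h.integral_weight_mul ht bV, ← integral_const_mul]
    refine integral_mono ((bV.mul (bN.mono hHG)).mono hG).integrable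
      ((BddMeas.const 3).mul (((bN.mono hHG).mul bl).mul (bx.sqrt.mono hHG))|>.mono hG).integrable
      fun ω => ?_
    have hl := h.l_mem t ω
    simp only [hw]
    by_cases hx : γ < x t ω
    · have hq := h.le_q t ω hx
      have hx0 : 0 < x t ω := hγ.trans hx
      simp only [frequent, hx, if_true, one_mul, mul_one]
      have hu1 : u ω ≤ √2 * √(x t ω) := by
        rw [← Real.sqrt_mul (by norm_num)]
        exact Real.sqrt_le_sqrt (by linarith)
      have hu2 : u ω * u ω = x t ω + γ := Real.mul_self_sqrt (by linarith)
      have h2 : u ω * u ω * u ω ≤ 3 * √(x t ω) * x t ω := by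
        have hs2 : √2 ≤ 3 / 2 := by
          rw [Real.sqrt_le_left (by norm_num)]; norm_num
        have hr := Real.sqrt_nonneg (x t ω)
        have : u ω ≤ 3 / 2 * √(x t ω) := hu1.trans (by gcongr)
        rw [hu2]
        calc _ ≤ (2 * x t ω) * (3 / 2 * √(x t ω)) := by
              gcongr
              · linarith
          _ = _ := by ring
      calc _ ≤ 1 / q t ω * (l t ω * 1 * (3 * √(x t ω) * q t ω)) := by
            have hq0 : 0 < q t ω := hx0.trans_le hq
            have hu0 : 0 ≤ u ω := Real.sqrt_nonneg _
            refine mul_le_mul_of_nonneg_left (mul_le_mul ?_ (h2.trans (by gcongr)) (by positivity)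
              (by linarith [hl.1])) (by positivity)
            exact mul_le_mul_of_nonneg_left hl.2 hl.1
        _ = _ := by
            have hq0 : 0 < q t ω := hx0.trans_le hq
            field_simp
    · simp [frequent, hx]
  rw [s1]
  refine s2.trans ?_
  rw [integral_add ((BddMeas.const η).mul i1).integrable
    ((BddMeas.const (1 / η)).mul i2).integrable, integral_const_mul, integral_const_mul]
  refine add_le_add ?_ (le_of_eq ?_)
  · rw [mul_comm 3 η, mul_assoc]
    exact mul_le_mul_of_nonneg_left s3 hη.le
  · have := h.integral_root_sq ht
    simp only [hu, hv]
    rw [this]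
    ring

/-- The potential telescopes, and its final value is nonnegative. -/
lemma sum_integral_regret_le {η : ℝ} (hη : 0 < η) :
    ∑ t ∈ Finset.range T, ∫ ω, frequent γ (x t) ω * l t ω * (x t ω - B ω) ∂P ≤
      3 * η * ∑ t ∈ Finset.range T, ∫ ω, frequent γ (x t) ω * l t ω * √(x t ω) ∂P +
        2 / η * ∫ ω, √(x 0 ω + γ) ∂P := by
  refine (Finset.sum_le_sum fun t ht =>
    h.integral_regret_le hη (Finset.mem_range.1 ht)).trans ?_
  rw [Finset.sum_add_distrib, ← Finset.mul_sum, ← Finset.mul_sum,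
    Finset.sum_range_sub' (fun t => ∫ ω, √(x t ω + γ) ∂P)]
  have : 0 ≤ ∫ ω, √(x T ω + γ) ∂P := integral_nonneg fun ω => Real.sqrt_nonneg _
  gcongr
  linarith

/-- The regret due to one arm. -/
lemma sum_integral_le {η κ ε L : ℝ} (hη : 0 < η) (hκ : 0 < κ) (hL : 0 ≤ L)
    (hBL : ∀ᵐ ω ∂P, B ω = 1 → ∑ t ∈ Finset.range T, l t ω ≤ L)
    (hq0 : ∀ t ω, x t ω ≤ γ → q t ω = 0)
    (hqε : ∀ t ω, γ < x t ω → q t ω ≤ x t ω + ε * q t ω) :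
    ∑ t ∈ Finset.range T, ∫ ω, l t ω * (q t ω - B ω) ∂P ≤
      ε * ∑ t ∈ Finset.range T, ∫ ω, l t ω * q t ω ∂P +
      3 / 2 * η * (κ * ∑ t ∈ Finset.range T, ∫ ω, l t ω * q t ω ∂P +
        1 / κ * (1 / γ + 4 * L + Real.exp (-2 * γ * L) / γ ^ 2)) +
      1 / η * (κ * (∫ ω, B ω ∂P + γ) + 1 / κ) := by
  have hγ := h.γ_pos
  have bl (t : ℕ) : BddMeas m0 (l t) := (h.bdd_l t t).mono (h.G_le t)
  have bB : BddMeas m0 B := (h.bdd_B 0).mono (h.G_le 0)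
  have bx (t : ℕ) : BddMeas m0 (x t) := (h.bdd_x t).mono (h.H_le t)
  have bq (t : ℕ) : BddMeas m0 (q t) := (h.bdd_q t).mono (h.H_le t)
  have bN (t : ℕ) : BddMeas m0 (frequent γ (x t)) := (h.bdd_frequent t).mono (h.H_le t)
  have amgm : ∀ y : ℝ, 0 ≤ y → √y ≤ 1 / 2 * (κ * y + 1 / κ) := fun y hy => by
    have e : 1 / 2 * (κ * y + 1 / κ) - √y = (κ * √y - 1) ^ 2 / (2 * κ) := by
      field_simp
      nlinarith [Real.sq_sqrt hy]
    exact sub_nonneg.1 (e ▸ by positivity)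
  have s1 : ∑ t ∈ Finset.range T, ∫ ω, l t ω * (q t ω - B ω) ∂P ≤
      ∑ t ∈ Finset.range T, ∫ ω, frequent γ (x t) ω * l t ω * (x t ω - B ω) ∂P +
      ε * ∑ t ∈ Finset.range T, ∫ ω, l t ω * q t ω ∂P := by
    rw [Finset.mul_sum, ← Finset.sum_add_distrib]
    refine Finset.sum_le_sum fun t _ => ?_
    rw [← integral_const_mul, ← integral_add
      (((bN t).mul (bl t)).mul ((bx t).sub bB)).integrable
      ((BddMeas.const ε).mul ((bl t).mul (bq t))).integrable]
    refine integral_mono ((bl t).mul ((bq t).sub bB)).integrable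
      ((((bN t).mul (bl t)).mul ((bx t).sub bB)).add
      ((BddMeas.const ε).mul ((bl t).mul (bq t)))).integrable fun ω => ?_
    -- In a non-rare round, passing from `q` to `x` costs `ε q`. In a rare round `q = 0`, and the
    -- term `-l B` is at most zero.
    have hl0 := (h.l_mem t ω).1
    by_cases hx : γ < x t ω
    · simp only [frequent, hx, if_true]
      nlinarith [hqε t ω hx]
    · simp only [frequent, hx, if_false, hq0 t ω (not_lt.1 hx)]
      rcases h.B_mem ω with hB | hB <;> simp [hB, hl0]
  have s2 : ∑ t ∈ Finset.range T, ∫ ω, frequent γ (x t) ω * l t ω * √(x t ω) ∂P ≤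
      1 / 2 * (κ * ∑ t ∈ Finset.range T, ∫ ω, l t ω * q t ω ∂P +
        1 / κ * ∫ ω, exposure γ l x T ω ∂P) := by
    unfold exposure
    rw [integral_finsetSum _ fun t _ => ((bN t).mul (bl t)).integrable, Finset.mul_sum,
      Finset.mul_sum, ← Finset.sum_add_distrib, Finset.mul_sum]
    refine Finset.sum_le_sum fun t _ => ?_
    rw [← integral_const_mul, ← integral_const_mul, ← integral_add
      ((BddMeas.const κ).mul ((bl t).mul (bq t))).integrable
      ((BddMeas.const (1 / κ)).mul ((bN t).mul (bl t))).integrable, ← integral_const_mul]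
    refine integral_mono (((bN t).mul (bl t)).mul (bx t).sqrt).integrable
      ((BddMeas.const (1 / 2)).mul (((BddMeas.const κ).mul ((bl t).mul (bq t))).add
      ((BddMeas.const (1 / κ)).mul ((bN t).mul (bl t))))).integrable fun ω => ?_
    have hl0 := (h.l_mem t ω).1
    by_cases hx : γ < x t ω
    · have h1 := h.le_q t ω hx
      simp only [frequent, hx, if_true, one_mul]
      calc _ ≤ l t ω * (1 / 2 * (κ * q t ω + 1 / κ)) := by
            refine mul_le_mul_of_nonneg_left ((amgm _ (h.x_mem t ω).1).trans ?_) hl0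
            gcongr
        _ = _ := by ring
    · simp [frequent, hx, hq0 t ω (not_lt.1 hx)]
  have s3 : ∫ ω, √(x 0 ω + γ) ∂P ≤ 1 / 2 * (κ * (∫ ω, B ω ∂P + γ) + 1 / κ) := by
    have e : ∫ ω, B ω ∂P = ∫ ω, x 0 ω ∂P := by
      simpa using h.law_B 0 (Nat.zero_le _) _ (.const 1)
    have i1 := ((BddMeas.const κ).mul ((bx 0).add (.const γ)))
    calc _ ≤ ∫ ω, 1 / 2 * (κ * (x 0 ω + γ) + 1 / κ) ∂P :=
          integral_mono ((bx 0).add (.const γ)).sqrt.integrable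
            ((BddMeas.const (1 / 2)).mul (i1.add (.const (1 / κ)))).integrable
            fun ω => amgm _ (by linarith [(h.x_mem 0 ω).1])
      _ = _ := by
          rw [e, integral_const_mul, integral_add i1.integrable (integrable_const _),
            integral_const_mul, integral_add (bx 0).integrable (integrable_const _)]
          simp
  have s4 := h.sum_integral_regret_le hη
  have s5 := h.integral_exposure_le hL hBL
  refine s1.trans ?_
  set Y := 1 / γ + 4 * L + Real.exp (-2 * γ * L) / γ ^ 2
  set Q := ∑ t ∈ Finset.range T, ∫ ω, l t ω * q t ω ∂P
  have s6 : 3 * η * ∑ t ∈ Finset.range T, ∫ ω, frequent γ (x t) ω * l t ω * √(x t ω) ∂P ≤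
      3 * η * (1 / 2 * (κ * Q + 1 / κ * Y)) := by
    refine mul_le_mul_of_nonneg_left (s2.trans ?_) (by positivity)
    gcongr
  have s7 := mul_le_mul_of_nonneg_left s3 (show 0 ≤ 2 / η by positivity)
  have e7 : 2 / η * (1 / 2 * (κ * (∫ ω, B ω ∂P + γ) + 1 / κ)) =
      1 / η * (κ * (∫ ω, B ω ∂P + γ) + 1 / κ) := by ring
  rw [e7] at s7
  linarith

end information

end ArmProcess

/-! ### The thresholded distribution -/

section thresholding

variable {d : ℕ} {γ : ℝ} {p : Fin d → ℝ}

lemma thresholded_of_le {i : Fin d} (hi : p i ≤ γ) : thresholded γ p i = 0 := by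
  simp [thresholded, hi]

/-- The mass of the rare arms. -/
lemma sum_rare_mem [DecidablePred fun j => p j ≤ γ] (hγ : 0 ≤ γ) (hp : ∀ j, 0 ≤ p j) :
    ∑ j ∈ Finset.univ.filter (fun j => p j ≤ γ), p j ∈ Icc 0 (d * γ) := by
  refine ⟨Finset.sum_nonneg fun j _ => hp j, ?_⟩
  rw [Finset.sum_filter]
  calc _ ≤ ∑ _j : Fin d, γ := Finset.sum_le_sum fun j _ => by split_ifs with h <;> assumption
    _ = d * γ := by simp

lemma thresholded_bounds (hγ : 0 ≤ γ) (hd : d * γ ≤ 1 / 2) (hp : ∀ j, 0 ≤ p j) {i : Fin d}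
    (hi : γ < p i) :
    p i ≤ thresholded γ p i ∧ thresholded γ p i ≤ 2 * p i ∧
      thresholded γ p i ≤ p i + d * γ * thresholded γ p i := by
  classical
  have hρ := sum_rare_mem hγ hp
  simp only [thresholded, not_le.2 hi, if_false]
  set ρ := ∑ j ∈ Finset.univ.filter (fun j => p j ≤ γ), p j with hρ_def
  have h1 : (0 : ℝ) < 1 - ρ := by linarith [hρ.2]
  have hpi := hp i
  have h2 : 0 ≤ p i / (1 - ρ) := by positivity
  have h3 : p i / (1 - ρ) = p i + ρ * (p i / (1 - ρ)) := by
    field_simp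
    ring
  have h4 : ρ * (p i / (1 - ρ)) ≤ d * γ * (p i / (1 - ρ)) := by
    gcongr
    exact hρ.2
  refine ⟨?_, ?_, by linarith⟩
  · nlinarith [mul_nonneg hρ.1 h2]
  · rw [div_le_iff₀ h1]
    nlinarith [hρ.2]

lemma thresholded_mem (hγ : 0 ≤ γ) (hd : d * γ ≤ 1 / 2) (hp : ∀ j, p j ∈ Icc (0 : ℝ) 1)
    (i : Fin d) : thresholded γ p i ∈ Icc (0 : ℝ) 2 := by
  rcases le_or_gt (p i) γ with hi | hi
  · simp [thresholded_of_le hi]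
  · have := thresholded_bounds hγ hd (fun j => (hp j).1) hi
    exact ⟨(hp i).1.trans this.1, by linarith [(hp i).2]⟩

lemma measurable_thresholded {Ω : Type*} {m : MeasurableSpace Ω} {x : Fin d → Ω → ℝ}
    (hx : ∀ j, Measurable[m] (x j)) (i : Fin d) :
    Measurable[m] (fun ω => thresholded γ (fun j => x j ω) i) := by
  classical
  simp only [thresholded, Finset.sum_filter]
  refine Measurable.ite (measurableSet_le (hx i) measurable_const) measurable_const ?_
  refine (hx i).div (measurable_const.sub (Finset.measurable_sum _ fun j _ => ?_))
  exact Measurable.ite (measurableSet_le (hx j) measurable_const) (hx j) measurable_const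

end thresholding

/-! ### From Thompson Sampling to arm processes -/

/-- Truncation to the unit interval. -/
noncomputable def clamp (y : ℝ) : ℝ := max 0 (min y 1)

lemma clamp_mem (y : ℝ) : clamp y ∈ Icc (0 : ℝ) 1 := by
  simp [clamp]

lemma clamp_of_mem {y : ℝ} (hy : y ∈ Icc (0 : ℝ) 1) : clamp y = y := by
  simp [clamp, hy.1, hy.2]

lemma measurable_clamp : Measurable clamp :=
  measurable_const.max (measurable_id.min measurable_const)

lemma bestLoss_eq {d T : ℕ} {s : (Fin T → Fin d → ℝ) → Fin d} (hs : IsBestArmSelector s)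
    (x : Fin T → Fin d → ℝ) : bestLoss x = armLoss x (s x) := by
  have : Nonempty (Fin d) := ⟨s x⟩
  exact le_antisymm (ciInf_le (Set.finite_range _).bddBelow _) (le_ciInf (hs.minimal x))

section thompson

variable {d T : ℕ} {Ω : Type*} (loss : Ω → Fin T → Fin d → ℝ) (a : Fin T → Ω → Fin d)
  (s : (Fin T → Fin d → ℝ) → Fin d) (γ : ℝ)

/-- The history of the player, with rounds in `ℕ`. -/
@[reducible] def playerInfo (t : ℕ) : MeasurableSpace Ω :=
  ⨆ r : Fin T, ⨆ _ : (r : ℕ) < t,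
    (MeasurableSpace.comap (a r) inferInstance ⊔
      MeasurableSpace.comap (fun ω => loss ω r (a r ω)) inferInstance)

/-- The history of the observer, with rounds in `ℕ`. -/
@[reducible] def observerInfo (t : ℕ) : MeasurableSpace Ω :=
  MeasurableSpace.comap loss inferInstance ⊔
    ⨆ r : Fin T, ⨆ _ : (r : ℕ) < t, MeasurableSpace.comap (a r) inferInstance

/-- The truncated loss of arm `i` in round `t`. -/
noncomputable def clampedLoss (i : Fin d) (t : ℕ) (ω : Ω) : ℝ :=
  if h : t < T then clamp (loss ω ⟨t, h⟩ i) else 0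

/-- The indicator that arm `i` is played in round `t`. -/
noncomputable def playIndicator (i : Fin d) (t : ℕ) (ω : Ω) : ℝ :=
  if h : t < T then ({ω | a ⟨t, h⟩ ω = i} : Set Ω).indicator (fun _ => (1 : ℝ)) ω else 0

/-- The indicator that arm `i` is the best one. -/
noncomputable def bestIndicator (i : Fin d) : Ω → ℝ :=
  ({ω | s (loss ω) = i} : Set Ω).indicator (fun _ => (1 : ℝ))

/-- The posterior probability that arm `i` is the best one, truncated to the unit interval. -/
noncomputable def belief [MeasurableSpace Ω] (P : Measure Ω) (i : Fin d) (t : ℕ) (ω : Ω) : ℝ :=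
  clamp ((P[bestIndicator loss s i | playerInfo loss a t]) ω)

lemma bestIndicator_mem (i : Fin d) (ω : Ω) :
    bestIndicator loss s i ω = 0 ∨ bestIndicator loss s i ω = 1 := by
  unfold bestIndicator
  by_cases h : s (loss ω) = i <;> simp [h]

lemma bestIndicator_mem_Icc (i : Fin d) (ω : Ω) : bestIndicator loss s i ω ∈ Icc (0 : ℝ) 1 := by
  rcases bestIndicator_mem loss s i ω with h | h <;> simp [h]

lemma playIndicator_mem (i : Fin d) (t : ℕ) (ω : Ω) :
    playIndicator a i t ω = 0 ∨ playIndicator a i t ω = 1 := by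
  unfold playIndicator
  split_ifs with ht
  · by_cases h : a ⟨t, ht⟩ ω = i <;> simp [h]
  · simp

lemma clampedLoss_mem (i : Fin d) (t : ℕ) (ω : Ω) : clampedLoss loss i t ω ∈ Icc (0 : ℝ) 1 := by
  unfold clampedLoss
  split_ifs with ht
  · exact clamp_mem _
  · simp

lemma playerInfo_mono : Monotone (playerInfo loss a) := fun _ _ h =>
  iSup_mono fun _ => iSup_mono' fun hr => ⟨lt_of_lt_of_le hr h, le_rfl⟩

lemma comap_arm_le {t : ℕ} {r : Fin T} (hr : (r : ℕ) < t) :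
    MeasurableSpace.comap (a r) inferInstance ≤ playerInfo loss a t :=
  le_sup_left.trans (le_iSup₂_of_le r hr le_rfl)

lemma comap_observed_le {t : ℕ} {r : Fin T} (hr : (r : ℕ) < t) :
    MeasurableSpace.comap (fun ω => loss ω r (a r ω)) inferInstance ≤ playerInfo loss a t :=
  le_sup_right.trans (le_iSup₂_of_le (f := fun (r : Fin T) (_ : (r : ℕ) < t) =>
    MeasurableSpace.comap (a r) inferInstance ⊔
      MeasurableSpace.comap (fun ω => loss ω r (a r ω)) inferInstance) r hr le_rfl)

lemma measurable_observerInfo_loss (t : ℕ) : Measurable[observerInfo loss a t] loss :=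
  measurable_iff_comap_le.2 le_sup_left

lemma measurable_observerInfo_arm {t : ℕ} {r : Fin T} (hr : (r : ℕ) < t) :
    Measurable[observerInfo loss a t] (a r) :=
  measurable_iff_comap_le.2 (le_trans (le_iSup₂_of_le r hr le_rfl) le_sup_right)

lemma playerInfo_le_observerInfo (t : ℕ) : playerInfo loss a t ≤ observerInfo loss a t := by
  refine iSup₂_le fun r hr => sup_le ?_ ?_
  · exact measurable_iff_comap_le.1 (measurable_observerInfo_arm loss a hr)
  · refine measurable_iff_comap_le.1 ?_
    -- The observed loss has a random index; summing over the finitely many arms exhibits its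
    -- measurability.
    have e : (fun ω => loss ω r (a r ω)) = fun ω => ∑ i, if a r ω = i then loss ω r i else 0 := by
      funext ω
      simp
    rw [e]
    refine Finset.measurable_sum _ fun i _ => Measurable.ite
      (measurable_observerInfo_arm loss a hr (measurableSet_singleton i)) ?_ measurable_const
    exact (measurable_pi_apply i).comp
      ((measurable_pi_apply r).comp (measurable_observerInfo_loss loss a t))

lemma observerInfo_le [m0 : MeasurableSpace Ω] (hloss : Measurable loss)
    (ha : ∀ t, Measurable (a t)) (t : ℕ) : observerInfo loss a t ≤ m0 :=
  sup_le (measurable_iff_comap_le.1 hloss)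
    (iSup₂_le fun r _ => measurable_iff_comap_le.1 (ha r))

variable [m0 : MeasurableSpace Ω] (P : Measure Ω) [IsProbabilityMeasure P]

lemma belief_ae_eq (hloss : Measurable loss) (hs : Measurable s) (i : Fin d) (t : ℕ) :
    P[bestIndicator loss s i | playerInfo loss a t] =ᵐ[P] belief loss a s P i t := by
  have hB : Integrable (bestIndicator loss s i) P :=
    (integrable_const (1 : ℝ)).indicator (hs.comp hloss (measurableSet_singleton i))
  have h0 : ∀ᵐ ω ∂P, 0 ≤ (P[bestIndicator loss s i | playerInfo loss a t]) ω :=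
    condExp_nonneg (ae_of_all _ fun ω => (bestIndicator_mem_Icc loss s i ω).1)
  have h1 : ∀ᵐ ω ∂P, (P[bestIndicator loss s i | playerInfo loss a t]) ω ≤ 1 := by
    by_cases hm : playerInfo loss a t ≤ m0
    · have := condExp_mono (m := playerInfo loss a t) hB (integrable_const (1 : ℝ))
        (ae_of_all _ fun ω => (bestIndicator_mem_Icc loss s i ω).2)
      rwa [condExp_const hm] at this
    · rw [condExp_of_not_le hm]
      exact ae_of_all _ fun ω => zero_le_one
  filter_upwards [h0, h1] with ω h0 h1
  exact (clamp_of_mem ⟨h0, h1⟩).symm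

/-- Under thresholded Thompson Sampling every arm is an `ArmProcess`. -/
lemma armProcess_of_thompson (hγ : 0 < γ) (hd : d * γ ≤ 1 / 2) (hloss : Measurable loss)
    (hs : Measurable s) (h : IsThresholdedThompson P loss s γ a) (i : Fin d) :
    ArmProcess P T γ (playerInfo loss a) (observerInfo loss a) (clampedLoss loss i)
      (belief loss a s P i) (fun t ω => thresholded γ (fun j => belief loss a s P j t ω) i)
      (playIndicator a i) (bestIndicator loss s i) := by
  have hx : ∀ j t, Measurable[playerInfo loss a t] (belief loss a s P j t) := fun j t =>
    measurable_clamp.comp stronglyMeasurable_condExp.measurable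
  have hx' : ∀ t ω j, belief loss a s P j t ω ∈ Icc (0 : ℝ) 1 := fun t ω j => clamp_mem _
  have hGle := observerInfo_le loss a hloss h.measurable
  have hHG := playerInfo_le_observerInfo loss a
  have hA : ∀ t, Measurable[playerInfo loss a (t + 1)] (playIndicator a i t) := fun t => by
    unfold playIndicator
    by_cases ht : t < T
    · simp only [ht, dif_pos]
      exact (measurable_const (a := (1 : ℝ))).indicator
        (measurable_iff_comap_le.2 (comap_arm_le loss a (r := ⟨t, ht⟩) t.lt_succ_self)
          (measurableSet_singleton i))
    · simp only [ht, dif_neg, not_false_eq_true]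
      exact measurable_const
  have hBm : ∀ t, Measurable[observerInfo loss a t] (bestIndicator loss s i) := fun t =>
    (measurable_const (a := (1 : ℝ))).indicator
      (hs.comp (measurable_observerInfo_loss loss a t) (measurableSet_singleton i))
  refine
    { H_mono := playerInfo_mono loss a
      H_le_G := hHG
      G_le := hGle
      γ_pos := hγ
      l_meas := fun r t => ?_
      l_mem := clampedLoss_mem loss i
      x_meas := hx i
      x_mem := fun t ω => hx' t ω i
      q_meas := fun t => measurable_thresholded (fun j => hx j t) i
      q_mem := fun t ω => thresholded_mem hγ.le hd (hx' t ω) i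
      le_q := fun t ω hi => (thresholded_bounds hγ.le hd (fun j => (hx' t ω j).1) hi).1
      A_meas := hA
      A_mem := playIndicator_mem a i
      Al_meas := fun t => ?_
      B_meas := hBm
      B_mem := bestIndicator_mem loss s i
      law_B := fun t _ f hf => ?_
      law_A := fun t ht f hf => ?_ }
  · unfold clampedLoss
    by_cases ht : r < T
    · simp only [ht, dif_pos]
      exact measurable_clamp.comp ((measurable_pi_apply i).comp
        ((measurable_pi_apply _).comp (measurable_observerInfo_loss loss a t)))
    · simp only [ht, dif_neg, not_false_eq_true]
      exact measurable_const
  · by_cases ht : t < T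
    · have e : (fun ω => playIndicator a i t ω * clampedLoss loss i t ω) =
          fun ω => playIndicator a i t ω * clamp (loss ω ⟨t, ht⟩ (a ⟨t, ht⟩ ω)) := by
        funext ω
        simp only [playIndicator, clampedLoss, ht, dif_pos]
        by_cases hi : a ⟨t, ht⟩ ω = i <;> simp [hi]
      rw [e]
      exact (hA t).mul (measurable_clamp.comp (measurable_iff_comap_le.2
        (comap_observed_le loss a (r := ⟨t, ht⟩) t.lt_succ_self)))
    · simp only [clampedLoss, ht, dif_neg, not_false_eq_true, mul_zero]
      exact measurable_const
  · exact integral_mul_eq_of_condExp_ae_eq ((hHG t).trans (hGle t)) hf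
      (.of_mem_Icc ((hBm t).mono (hGle t) le_rfl) (bestIndicator_mem_Icc loss s i))
      (belief_ae_eq loss a s P hloss hs i t)
  · refine integral_mul_eq_of_condExp_ae_eq (hGle t) hf
      (.of_mem_Icc (a := 0) (b := 1)
        ((hA t).mono ((hHG _).trans (hGle _)) le_rfl) fun ω => ?_) ?_
    · rcases playIndicator_mem a i t ω with h | h <;> simp [h]
    · have e : playIndicator a i t =
          ({ω | a ⟨t, ht⟩ ω = i} : Set Ω).indicator (fun _ => (1 : ℝ)) := by
        funext ω
        simp only [playIndicator, ht, dif_pos]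
      rw [e]
      -- Truncation alters the posteriors only on a null set, and the two indexings of the histories
      -- agree definitionally.
      refine (h.law ⟨t, ht⟩ i).trans ?_
      filter_upwards [ae_all_iff.2 fun j => belief_ae_eq loss a s P hloss hs j t] with ω hω
      simp only [← hω]
      rfl

end thompson

/-! ### Numerical estimates -/

lemma log_lower_bound {L : ℝ} (hL : 2 ≤ L) : 0.69 ≤ Real.log L :=
  (by linarith [Real.log_two_gt_d9] : (0.69 : ℝ) ≤ Real.log 2).trans
    (Real.log_le_log (by norm_num) hL)

/-- The numerical part of the regret bound. -/
lemma regret_bound_of_self_bounding {D L x η κ R M : ℝ} (hD : 1 ≤ D) (hL : 2 ≤ L)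
    (hx : x = Real.log L) (hxD : D * (x ^ 2 / L) ≤ 1 / 2) (hκ : κ = √D) (hη : η = 1 / (8 * √L))
    (hM : M ≤ L + R)
    (hR : R ≤ D * (x ^ 2 / L) * M + 3 / 2 * η * (κ * M + D * (1 / κ * (12 * L))) +
      1 / η * (κ * (1 + D * (x ^ 2 / L)) + D * (1 / κ))) :
    R ≤ 100 * (√(D * L) + D * x ^ 2) := by
  have hx0 : 0.69 ≤ x := hx ▸ log_lower_bound hL
  have hκ0 : 0 < κ := hκ ▸ Real.sqrt_pos.2 (by linarith)
  have hκ2 : D = κ ^ 2 := by rw [hκ, Real.sq_sqrt (by linarith)]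
  set b := √L with hb
  have hb0 : 0 < b := Real.sqrt_pos.2 (by linarith)
  have hb2 : L = b ^ 2 := by rw [hb, Real.sq_sqrt (by linarith)]
  have hs : √(D * L) = κ * b := by
    rw [Real.sqrt_mul (by linarith), ← hκ]
  rw [hs]
  rcases le_or_gt R 0 with hR0 | hR0
  · have : 0 ≤ 100 * (κ * b + D * x ^ 2) := by positivity
    linarith
  set y := D * (x ^ 2 / L) with hy
  have hy0 : 0 ≤ y := by positivity
  have hyL : y * L = D * x ^ 2 := by
    rw [hy]; field_simp
  -- The threshold condition gives `D x² ≤ L / 2`, and `x ≥ 0.69`, so `D ≤ 1.03² L`.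
  have hratio : κ ≤ 1.03 * b := by
    refine le_of_sq_le_sq ?_ (by positivity)
    rw [mul_pow, ← hκ2, ← hb2]
    have h1 : D * x ^ 2 ≤ L / 2 := by rw [← hyL]; nlinarith
    have h2 : D * 0.69 ^ 2 ≤ D * x ^ 2 := by gcongr
    nlinarith
  have h1 : D * (1 / κ) = κ := by rw [hκ2]; field_simp
  have e1 : y * M ≤ D * x ^ 2 + R / 2 := by
    have := mul_le_mul_of_nonneg_left hM hy0
    nlinarith
  have e2 : 3 / 2 * η * (κ * M + D * (1 / κ * (12 * L))) ≤
      3 / 16 * (1.03 * R + 13 * (κ * b)) := by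
    have h2 : D * (1 / κ * (12 * L)) = 12 * κ * L := by
      rw [← mul_assoc, h1]; ring
    rw [h2, hη]
    have h3 : 3 / 2 * (1 / (8 * b)) * (κ * M + 12 * κ * L) = 3 / 16 * (κ * (M + 12 * L) / b) := by
      field_simp
      ring
    rw [h3]
    gcongr
    rw [div_le_iff₀ hb0]
    have h4 : κ * (M + 12 * L) ≤ κ * (R + 13 * L) := by gcongr κ * ?_; linarith
    have h5 : κ * R ≤ 1.03 * b * R := by gcongr
    rw [hb2] at h4
    nlinarith
  have e3 : 1 / η * (κ * (1 + y) + D * (1 / κ)) ≤ 20 * (κ * b) := by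
    rw [h1, hη, one_div_one_div]
    have : 8 * b * (κ * (1 + y) + κ) ≤ 8 * b * (κ * (1 + 1 / 2) + κ) := by gcongr
    linarith
  -- On the right, `R` has total coefficient `1/2 + 3/16 * 1.03 < 1`, so it can be absorbed.
  have h6 : 0 ≤ κ * b := by positivity
  have h7 : 0 ≤ D * x ^ 2 := by positivity
  linarith

/-- With `γ = x² / L` the exponential becomes `exp (-2 x²)`, which is at most `1 / L = exp (-x)`
because `x ≥ 1/2`; this compensates one factor `L` of `1 / γ²`. -/
lemma exposure_bound {L x : ℝ} (hL : 2 ≤ L) (hx : x = Real.log L) :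
    1 / (x ^ 2 / L) + 4 * L + Real.exp (-2 * (x ^ 2 / L) * L) / (x ^ 2 / L) ^ 2 ≤ 12 * L := by
  have hL0 : 0 < L := by linarith
  have hx0 : 0.69 ≤ x := hx ▸ log_lower_bound hL
  have hx1 : 0 < x := by linarith
  have hx2 : (0.47 : ℝ) ≤ x ^ 2 := by nlinarith
  have e1 : 1 / (x ^ 2 / L) ≤ 3 * L := by
    rw [one_div_div, div_le_iff₀ (by positivity)]
    nlinarith
  have e2 : Real.exp (-2 * (x ^ 2 / L) * L) / (x ^ 2 / L) ^ 2 ≤ 5 * L := by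
    have h1 : -2 * (x ^ 2 / L) * L = -2 * x ^ 2 := by field_simp
    rw [h1, div_le_iff₀ (by positivity)]
    have h2 : L * Real.exp (-2 * x ^ 2) ≤ 1 := by
      nth_rewrite 1 [← Real.exp_log hL0]
      rw [← hx, ← Real.exp_add, Real.exp_le_one_iff]
      nlinarith
    have h3 : (1 : ℝ) ≤ 5 * (x ^ 2) ^ 2 := by nlinarith
    calc Real.exp (-2 * x ^ 2) = (L * Real.exp (-2 * x ^ 2)) / L := by field_simp
      _ ≤ 5 * (x ^ 2) ^ 2 / L := div_le_div_of_nonneg_right (h2.trans h3) hL0.le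
      _ = _ := by field_simp
  linarith

/-! ### The regret bound -/

theorem mainTheorem10 :
    ∃ C : ℝ, 0 < C ∧
      ∀ (d T : ℕ) (L γ : ℝ), 0 < d → 2 ≤ L →
        γ = Real.log L ^ 2 / L → γ ≤ 1 / (2 * (d : ℝ)) →
      ∀ (Ω : Type*) [MeasurableSpace Ω] (P : Measure Ω) [IsProbabilityMeasure P]
        (loss : Ω → Fin T → Fin d → ℝ) (s : (Fin T → Fin d → ℝ) → Fin d)
        (a : Fin T → Ω → Fin d),
        Measurable loss →
        (∀ᵐ ω ∂P, ∀ t i, loss ω t i ∈ Icc (0 : ℝ) 1) →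
        IsBestArmSelector s →
        (∀ᵐ ω ∂P, bestLoss (loss ω) ≤ L) →
        IsThresholdedThompson P loss s γ a →
        expectedRegret P loss a ≤ C * (Real.sqrt (d * L) + d * Real.log L ^ 2) := by
  refine ⟨100, by norm_num, ?_⟩
  intro d T L γ hd hL hγ hγd Ω m0 P hP loss s a hloss hmem hs hbest hTS
  have hL0 : 0 < L := by linarith
  have hlog := log_lower_bound hL
  have hγ0 : 0 < γ := by
    have : 0 < Real.log L := by linarith
    rw [hγ]
    positivity
  have hd1 : (1 : ℝ) ≤ d := by exact_mod_cast hd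
  have hdγ : d * γ ≤ 1 / 2 := by
    rw [le_div_iff₀ (by positivity)] at hγd
    linarith
  set l := clampedLoss loss
  set B := bestIndicator loss s
  set A := playIndicator (T := T) a
  set q : Fin d → ℕ → Ω → ℝ := fun i t ω =>
    thresholded γ (fun j => belief loss a s P j t ω) i with hq
  have hp : ∀ t ω j, 0 ≤ belief loss a s P j t ω := fun t ω j => (clamp_mem _).1
  have hX : ∀ i, ArmProcess P T γ (playerInfo loss a) (observerInfo loss a) (l i)
      (belief loss a s P i) (q i) (A i) (B i) :=
    armProcess_of_thompson loss a s γ P hγ0 hdγ hloss hs.measurable hTS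
  have bl (i t) : BddMeas m0 (l i t) := ((hX i).bdd_l t t).mono ((hX i).G_le t)
  have bq (i t) : BddMeas m0 (q i t) := ((hX i).bdd_q t).mono ((hX i).H_le t)
  have bA (i t) : BddMeas m0 (A i t) := ((hX i).bdd_A t).mono ((hX i).H_le _)
  have bB (i) : BddMeas m0 (B i) := ((hX i).bdd_B 0).mono ((hX i).G_le 0)
  have hl : ∀ᵐ ω ∂P, ∀ (t : Fin T) i, l i t ω = loss ω t i := by
    filter_upwards [hmem] with ω hω t i
    simp only [l, clampedLoss, t.2, dif_pos]
    exact clamp_of_mem (hω t i)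
  have hsum : ∀ (f : ℕ → ℝ), ∑ t ∈ Finset.range T, f t = ∑ t : Fin T, f t :=
    fun f => Finset.sum_range f
  have hplayed : ∀ᵐ ω ∂P, ∑ t, loss ω t (a t ω) =
      ∑ i, ∑ t ∈ Finset.range T, l i t ω * A i t ω := by
    filter_upwards [hl] with ω hω
    rw [Finset.sum_comm, hsum]
    refine Finset.sum_congr rfl fun t _ => ?_
    simp only [hω, A, playIndicator, t.2, dif_pos, Fin.eta, indicator_apply, mem_ofPred_eq,
      mul_ite, mul_one, mul_zero, Finset.sum_ite_eq, Finset.mem_univ, if_true]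
  have hbestSum : ∀ᵐ ω ∂P, bestLoss (loss ω) =
      ∑ i, ∑ t ∈ Finset.range T, l i t ω * B i ω := by
    filter_upwards [hl] with ω hω
    rw [Finset.sum_comm, hsum, bestLoss_eq hs, armLoss]
    refine Finset.sum_congr rfl fun t _ => ?_
    simp only [hω, B, bestIndicator, indicator_apply, mem_ofPred_eq,
      mul_ite, mul_one, mul_zero, Finset.sum_ite_eq, Finset.mem_univ, if_true]
  have hBL (i) : ∀ᵐ ω ∂P, B i ω = 1 → ∑ t ∈ Finset.range T, l i t ω ≤ L := by
    filter_upwards [hl, hbest] with ω hω hb hB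
    have hsi : s (loss ω) = i := by
      by_contra hne
      simp [B, bestIndicator, hne] at hB
    rw [bestLoss_eq hs, armLoss, hsi] at hb
    rw [hsum]
    simpa only [hω] using hb
  set M := ∑ i, ∑ t ∈ Finset.range T, ∫ ω, l i t ω * q i t ω ∂P with hM
  set R := ∑ i, ∑ t ∈ Finset.range T, ∫ ω, l i t ω * (q i t ω - B i ω) ∂P with hR
  have hRM : R = M - ∫ ω, bestLoss (loss ω) ∂P := by
    rw [integral_congr_ae hbestSum, integral_finsetSum _ fun i _ =>
      (BddMeas.sum _ fun t _ => (bl i t).mul (bB i)).integrable, hR, hM,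
      ← Finset.sum_sub_distrib]
    refine Finset.sum_congr rfl fun i _ => ?_
    rw [integral_finsetSum _ fun t _ => ((bl i t).mul (bB i)).integrable,
      ← Finset.sum_sub_distrib]
    refine Finset.sum_congr rfl fun t _ => ?_
    rw [← integral_sub ((bl i t).mul (bq i t)).integrable ((bl i t).mul (bB i)).integrable]
    simp only [mul_sub]
  have iA : Integrable (fun ω => ∑ i, ∑ t ∈ Finset.range T, l i t ω * A i t ω) P :=
    (BddMeas.sum _ fun i _ => BddMeas.sum _ fun t _ => (bl i t).mul (bA i t)).integrable
  have iB : Integrable (fun ω => bestLoss (loss ω)) P :=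
    (BddMeas.sum Finset.univ fun i _ => BddMeas.sum (Finset.range T) fun t _ =>
      (bl i t).mul (bB i)).integrable.congr (hbestSum.mono fun ω h => h.symm)
  have hregret : expectedRegret P loss a = R := by
    rw [hRM, expectedRegret, integral_sub (iA.congr (hplayed.mono fun ω h => h.symm)) iB,
      integral_congr_ae hplayed, integral_finsetSum _ fun i _ =>
      (BddMeas.sum _ fun t _ => (bl i t).mul (bA i t)).integrable]
    congr 1
    refine Finset.sum_congr rfl fun i _ => ?_
    rw [integral_finsetSum _ fun t _ => ((bl i t).mul (bA i t)).integrable]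
    exact Finset.sum_congr rfl fun t ht =>
      (hX i).law_A t (Finset.mem_range.1 ht) _ ((hX i).bdd_l t t)
  -- Self-bounding: the player's expected loss is the regret plus `E[L*] ≤ L`.
  have hML : M ≤ L + R := by
    have : ∫ ω, bestLoss (loss ω) ∂P ≤ L := by
      simpa using integral_mono_ae iB (integrable_const L) hbest
    linarith
  have hB1 : ∑ i, ∫ ω, B i ω ∂P = 1 := by
    rw [← integral_finsetSum _ fun i _ => (bB i).integrable]
    simp [B, bestIndicator, indicator_apply]
  have hη0 : 0 < 1 / (8 * √L) := by positivity
  have hκ0 : 0 < √(d : ℝ) := by positivity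
  -- The choice `ε = d γ` bounds the total mass of the rare arms.
  have key := Finset.sum_le_sum fun i (_ : i ∈ Finset.univ) =>
    (hX i).sum_integral_le hη0 hκ0 hL0.le (hBL i) (ε := d * γ)
      (fun t ω hi => thresholded_of_le hi)
      (fun t ω hi => (thresholded_bounds hγ0.le hdγ (hp t ω) hi).2.2)
  simp only [Finset.sum_add_distrib, ← Finset.mul_sum, hB1, Finset.sum_const, Finset.card_univ,
    Fintype.card_fin, nsmul_eq_mul] at key
  rw [hregret]
  refine regret_bound_of_self_bounding hd1 hL rfl (hγ ▸ hdγ) rfl rfl hML (key.trans ?_)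
  have hE := exposure_bound hL rfl
  rw [← hγ] at hE ⊢
  rw [mul_left_comm (d : ℝ) (1 / √(d : ℝ)) (12 * L)]
  have hdE := mul_le_mul_of_nonneg_left hE (by positivity : (0 : ℝ) ≤ d)
  gcongr
  linarith
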